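/- Let $\mathbf P$ be either the family $\mathbf B$ of probability distributions supported in $[0,1]$, or, for some $\varepsilon>0$ and $\Gamma>0$, the family $\mathbf H$ of probability distributions on $\mathbb R$ with $\mathbb E|X|^{1+\varepsilon}\le\Gamma$. Write $m(\kappa)$ for the mean of $\kappa$, and let $\underline\mu=\inf_{\kappa\in\mathbf P}m(\kappa)$, $\overline\mu=\sup_{\kappa\in\mathbf P}m(\kappa)$ (so $0,1$ for $\mathbf B$ and $\mp\Gamma^{1/(1+\varepsilon)}$ for $\mathbf H$). For $\nu\in\mathbf P$ and $x\in\mathbb R$ let $$KL_{\inf}(\nu,\mathbf P,x)=\begin{cases}\inf\{KL(\nu,\kappa):\kappa\in\mathbf P,\ m(\kappa)\ge x\}, & x\ge m(\nu),\\ \inf\{KL(\nu,\kappa):\kappa\in\mathbf P,\ m(\kappa)\le x\}, & x<m(\nu),\end{cases}\qquad \inf\emptyset=\infty .$$ Let $\nu\in\mathbf P$ with mean $\mu=m(\nu)$. The samples $X_1,X_2,\dots$ are i.i.d. with law $\nu$, and their costs $c_1,c_2,\dots$ are i.i.d. with law $\mathcal C$, independent of the samples, where $\mathcal C$ is supported on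 the positive reals and has mean $0<\overline c<\infty$. A budget $C_\delta$ with $C_\delta\to\infty$ as $\delta\to0^+$ allows $\tau_\delta=\sup\{n\ge1:\sum_{i=1}^n c_i\le C_\delta\}$ samples ($\sup\emptyset=0$). A policy $\pi$ reports at every $n$ and $\delta$ an interval $[\hat\mu_L(n,\delta),\hat\mu_R(n,\delta)]$ with endpoints in $[-\infty,\infty]$ that are measurable functions of $X_1,\dots,X_n$. Suppose that * (coverage) for every $\delta\in(0,1)$ and every $\kappa\in\mathbf P$, if the samples have law $\kappa$ then $m(\kappa)\in[\hat\mu_L(\tau_\delta,\delta),\hat\mu_R(\tau_\delta,\delta)]$ with probability at least $1-\delta$; * (stability) when the samples have law $\nu$, $\hat\mu_L(\tau_\delta,\delta)\to\mu_L^\pi$ and $\hat\mu_R(\tau_\delta,\delta)\to\mu_R^\pi$ in probability as $\delta\to0^+$, for constants $-\infty\le\mu_L^\pi\le\mu\le\mu_R^\pi\le\infty$. Then the following holds. (a) No learning regime. If $C_\delta/\log(1/\delta)\to0$, then $\mu_L^\pi\le\underline\mu$ and $\mu_R^\pi\ge\overline\mu$, hence $\mu_R^\pi-\mu_L^\pi\ge\overline\mu-\underline\mu$.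 If moreover $\pi$ reports only $\hat\mu_L\ge\underline\mu$ and $\hat\mu_R\le\overline\mu$, then $\mu_R^\pi-\mu_L^\pi=\overline\mu-\underline\mu$, and $\hat\mu_L(\tau_\delta,\delta)\to\underline\mu$ and $\hat\mu_R(\tau_\delta,\delta)\to\overline\mu$ in probability. (b) Sufficient learning regime. If $C_\delta/\log(1/\delta)\to k$ for some $k\in(0,\infty)$, and $\underline\mu<\mu<\overline\mu$, then there is exactly one pair $\mu_L^*<\mu<\mu_R^*$ of real numbers with $$KL_{\inf}(\nu,\mathbf P,\mu_R^*)=KL_{\inf}(\nu,\mathbf P,\mu_L^*)=\frac{\overline c}{k},$$ and $\mu_R^\pi-\mu_L^\pi\ge\mu_R^*-\mu_L^*$. -/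

import Mathlib

open MeasureTheory Filter Topology

noncomputable section

namespace CIWidth

/-- The mean `m(κ)` of a distribution on the real line. (Every member of the two families below has
a finite first moment.) -/
def mean (κ : ProbabilityMeasure ℝ) : ℝ := ∫ x, x ∂(κ : Measure ℝ)

/-- The family `B` of all distributions supported in `[0, 1]`. -/
def boundedFamily : Set (ProbabilityMeasure ℝ) :=
  {κ | ∀ᵐ x ∂(κ : Measure ℝ), x ∈ Set.Icc (0 : ℝ) 1}

/-- The family `H` of all distributions with `E |X| ^ (1 + ε) ≤ Γ`. -/
def momentFamily (ε Γ : ℝ) : Set (ProbabilityMeasure ℝ) :=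
  {κ | ∫⁻ x, ENNReal.ofReal (|x| ^ (1 + ε)) ∂(κ : Measure ℝ) ≤ ENNReal.ofReal Γ}

/-- The smallest possible mean (infimum of the means over the family `P`). -/
def minMean (P : Set (ProbabilityMeasure ℝ)) : EReal := ⨅ κ ∈ P, (mean κ : EReal)

/-- The largest possible mean (supremum of the means over the family `P`). -/
def maxMean (P : Set (ProbabilityMeasure ℝ)) : EReal := ⨆ κ ∈ P, (mean κ : EReal)

/-- `KL_inf(ν, P, x)`, with the convention that the infimum of the empty set is `∞`. -/
def klInf (ν : ProbabilityMeasure ℝ) (P : Set (ProbabilityMeasure ℝ)) (x : ℝ) : ENNReal :=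
  if mean ν ≤ x then
    ⨅ κ ∈ {κ ∈ P | x ≤ mean κ}, InformationTheory.klDiv (ν : Measure ℝ) (κ : Measure ℝ)
  else
    ⨅ κ ∈ {κ ∈ P | mean κ ≤ x}, InformationTheory.klDiv (ν : Measure ℝ) (κ : Measure ℝ)

/-- The joint law of the i.i.d. samples `X₁, X₂, …` from `ν` (first component, `X_{i+1} = ω.1 i`)
and of the i.i.d. costs `c₁, c₂, …` from `𝒞` (second component), independent of each other. -/
def envLaw (ν 𝒞 : ProbabilityMeasure ℝ) : Measure ((ℕ → ℝ) × (ℕ → ℝ)) :=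
  (Measure.infinitePi fun _ : ℕ => (ν : Measure ℝ)).prod
    (Measure.infinitePi fun _ : ℕ => (𝒞 : Measure ℝ))

/-- The number of samples that the budget `C` pays for: `sup {n ≥ 1 : c₁ + ⋯ + c_n ≤ C}`, which
is `0` when already the first sample is too expensive. -/
def numSamples (C : ℝ) (c : ℕ → ℝ) : ℕ :=
  sSup {n : ℕ | 0 < n ∧ ∑ i ∈ Finset.range n, c i ≤ C}

/-- A method for constructing confidence intervals: for every sample size `n`, every observed
`(X₁, …, X_n)` and every level `δ` it reports a lower and an upper endpoint (possibly infinite),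
each a measurable function of the observations. -/
structure Policy where
  lower : (n : ℕ) → ℝ → (Fin n → ℝ) → EReal
  upper : (n : ℕ) → ℝ → (Fin n → ℝ) → EReal
  measurable_lower : ∀ n δ, Measurable (lower n δ)
  measurable_upper : ∀ n δ, Measurable (upper n δ)

/-- The lower endpoint reported at level `δ` from the samples that the budget `C` pays for. -/
def Policy.lowerAt (π : Policy) (C δ : ℝ) (ω : (ℕ → ℝ) × (ℕ → ℝ)) : EReal :=
  π.lower (numSamples C ω.2) δ fun i => ω.1 i

/-- The upper endpoint reported at level `δ` from the samples that the budget `C` pays for. -/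
def Policy.upperAt (π : Policy) (C δ : ℝ) (ω : (ℕ → ℝ) × (ℕ → ℝ)) : EReal :=
  π.upper (numSamples C ω.2) δ fun i => ω.1 i

/-- Coverage: for every `δ ∈ (0, 1)` and every distribution `κ` of the family `P`, the interval
reported with budget `C δ` contains the mean of `κ` with probability at least `1 - δ` when the
samples come from `κ`. -/
def Policy.Covers (π : Policy) (P : Set (ProbabilityMeasure ℝ)) (𝒞 : ProbabilityMeasure ℝ)
    (C : ℝ → ℝ) : Prop :=
  ∀ δ ∈ Set.Ioo (0 : ℝ) 1, ∀ κ ∈ P,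
    ENNReal.ofReal (1 - δ) ≤
      envLaw κ 𝒞 {ω | (mean κ : EReal) ∈ Set.Icc (π.lowerAt (C δ) δ ω) (π.upperAt (C δ) δ ω)}

/-- Convergence in probability, as `δ → 0+`, of extended-real random variables `Y δ` to a constant
`a ∈ [-∞, ∞]`. -/
def TendstoInProb {Ω : Type*} [MeasurableSpace Ω] (ℙ : Measure Ω) (Y : ℝ → Ω → EReal)
    (a : EReal) : Prop :=
  ∀ U ∈ 𝓝 a, Tendsto (fun δ => ℙ {ω | Y δ ω ∉ U}) (𝓝[>] (0 : ℝ)) (𝓝 0)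

/-- Stability at `ν`: the endpoints converge in probability to constants `L ≤ m(ν) ≤ R`. -/
def Policy.StableAt (π : Policy) (ν 𝒞 : ProbabilityMeasure ℝ) (C : ℝ → ℝ) (L R : EReal) : Prop :=
  L ≤ (mean ν : EReal) ∧ (mean ν : EReal) ≤ R ∧
    TendstoInProb (envLaw ν 𝒞) (fun δ => π.lowerAt (C δ) δ) L ∧
    TendstoInProb (envLaw ν 𝒞) (fun δ => π.upperAt (C δ) δ) R

/-- The reported intervals lie in the range of possible means of the family `P`. -/
def Policy.ReportsWithin (π : Policy) (P : Set (ProbabilityMeasure ℝ)) : Prop :=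
  ∀ n, ∀ δ ∈ Set.Ioo (0 : ℝ) 1, ∀ x, minMean P ≤ π.lower n δ x ∧ π.upper n δ x ≤ maxMean P

/-- `(xL, xR)` solves the system `KL_inf(ν, P, xR) = KL_inf(ν, P, xL) = r`, `xL < m(ν) < xR`. -/
def SolvesSystem (ν : ProbabilityMeasure ℝ) (P : Set (ProbabilityMeasure ℝ)) (r xL xR : ℝ) :
    Prop :=
  xL < mean ν ∧ mean ν < xR ∧
    klInf ν P xR = ENNReal.ofReal r ∧ klInf ν P xL = ENNReal.ofReal r

end CIWidth

end

/-! The engine is a change of measure. Let D = KL(ν, κ) be finite, and suppose the interval excludes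
m(κ) with ν-probability tending to 1. Let B be the event that m(κ) is missed and at most n ≈ θ C_δ
samples are bought. Costs have the same law in both models, so B is seen through data whose
divergence is at most n D. Coverage gives κ(B) ≤ δ, and the law of large numbers for costs gives
ν(B) → 1 when θ c̄ > 1. The Donsker–Varadhan inequality with multiplier log(1/δ) yields log(1/δ)
ν(B) ≤ n D + log 2; dividing by log(1/δ) and letting δ → 0 gives 1 ≤ θ k D. If k D < c̄, some θ
violates this. So [L, R] contains m(κ) whenever k D < c̄ (`not_tendsto_envLaw_coverSet`,
`Policy.StableAt.le_mean_le`).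

If k = 0, every κ with finite divergence qualifies. Mixing ν with the point mass of extremal mean
produces such κ with means up to the extreme, which is (a).

If k > 0, consider the least divergence from ν at mean level x as x moves from m(ν) towards the
extreme. Mixing with the extremal law makes it finite and continuous, mixing with ν makes it
strictly increasing at positive finite values, and a Markov bound makes it unbounded near the
extreme. It takes the value c̄/k exactly once; below that point there are admissible κ, which gives
(b). Both sides are handled together by maximizing ±m, an `ExtremalFunctional` on either family. -/

namespace InformationTheory

/-! ### Relative entropy: Donsker–Varadhan, products, mixtures. -/

open ProbabilityTheory

variable {α β : Type*} [MeasurableSpace α] [MeasurableSpace β]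

/-- The Donsker–Varadhan inequality for a multiple of an indicator function. -/
lemma mul_measureReal_le_toReal_klDiv_add_log (μ ν : Measure α) [IsProbabilityMeasure μ]
    [IsProbabilityMeasure ν] (h : klDiv μ ν ≠ ⊤) {B : Set α} (hB : MeasurableSet B) (t : ℝ) :
    t * μ.real B ≤ (klDiv μ ν).toReal + Real.log (1 + (Real.exp t - 1) * ν.real B) := by
  obtain ⟨hac, hint⟩ := klDiv_ne_top_iff.1 h
  set f : α → ℝ := B.indicator fun _ => t with hf
  have hexp : (fun x => Real.exp (f x)) = fun x => 1 + B.indicator (fun _ => Real.exp t - 1) x := by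
    funext x
    by_cases hx : x ∈ B <;> simp [hf, hx]
  have hi (ρ : Measure α) [IsFiniteMeasure ρ] (c : ℝ) : Integrable (B.indicator fun _ => c) ρ :=
    (integrable_const c).indicator hB
  have hfν : Integrable (fun x => Real.exp (f x)) ν := by
    rw [hexp]
    exact (integrable_const _).add (hi ν _)
  have hval : ∫ x, Real.exp (f x) ∂ν = 1 + (Real.exp t - 1) * ν.real B := by
    rw [hexp, integral_add (integrable_const _) (hi ν _), integral_indicator_const _ hB]
    simp [mul_comm]
  have hfval : ∫ x, f x ∂μ = t * μ.real B := by
    rw [hf, integral_indicator_const _ hB, smul_eq_mul, mul_comm]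
  have : IsProbabilityMeasure (ν.tilted f) := isProbabilityMeasure_tilted hfν
  -- Gibbs' principle: the divergence of `μ` from the exponentially tilted `ν` is nonnegative, and
  -- it equals KL(μ, ν) minus the `μ`-mean of `f` plus the log-partition function.
  have hkey := integral_llr_tilted_right hac (hi μ t) hfν hint
  have hnn := integral_llr_add_sub_measure_univ_nonneg
    (hac.trans (absolutelyContinuous_tilted hfν))
    (integrable_llr_tilted_right hac (hi μ t) hint hfν)
  rw [toReal_klDiv_of_measure_eq hac (by simp)]
  simp only [probReal_univ] at hnn
  rw [hval, hfval] at hkey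
  linarith

/-- The chain rule with constant kernels replaces one factor at a time; data processing along the
coordinate swap brings the second factor to the front. -/
lemma klDiv_prod_le (μ₁ ν₁ : Measure α) (μ₂ ν₂ : Measure β) [IsProbabilityMeasure μ₁]
    [IsProbabilityMeasure ν₁] [IsProbabilityMeasure μ₂] [IsProbabilityMeasure ν₂] :
    klDiv (μ₁.prod μ₂) (ν₁.prod ν₂) ≤ klDiv μ₁ ν₁ + klDiv μ₂ ν₂ := by
  have h1 : klDiv (μ₁.prod μ₂) (ν₁.prod ν₂) = klDiv μ₁ ν₁ + klDiv (μ₁.prod μ₂) (μ₁.prod ν₂) := by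
    simpa only [Measure.compProd_const] using
      klDiv_compProd_eq_add μ₁ ν₁ (Kernel.const α μ₂) (Kernel.const α ν₂)
  have h2 : klDiv (μ₂.prod μ₁) (ν₂.prod μ₁) = klDiv μ₂ ν₂ := by
    simpa only [Measure.compProd_const] using
      klDiv_compProd_left μ₂ ν₂ (Kernel.const β μ₁)
  rw [h1, ← h2, ← Measure.prod_swap (μ := μ₁) (ν := μ₂), ← Measure.prod_swap (μ := μ₁) (ν := ν₂)]
  gcongr
  rw [Measure.prod_swap, Measure.prod_swap, ← Measure.prod_swap (μ := μ₂) (ν := μ₁),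
    ← Measure.prod_swap (μ := ν₂) (ν := μ₁)]
  exact klDiv_map_le _ _ measurable_swap

lemma klDiv_pi_le (μ ν : Measure α) [IsProbabilityMeasure μ] [IsProbabilityMeasure ν] (n : ℕ) :
    klDiv (Measure.pi fun _ : Fin n => μ) (Measure.pi fun _ : Fin n => ν) ≤ n * klDiv μ ν := by
  induction n with
  | zero =>
    rw [Measure.pi_of_empty (fun _ : Fin 0 => μ), Measure.pi_of_empty (fun _ : Fin 0 => ν)]
    simp
  | succ n ih =>
    have hs (ρ : Measure α) [IsProbabilityMeasure ρ] :=
      ((measurePreserving_piFinSuccAbove (fun _ : Fin (n + 1) => ρ) 0).symm _).map_eq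
    rw [← hs μ, ← hs ν]
    refine (klDiv_map_le _ _ (MeasurableEquiv.measurable _)).trans ((klDiv_prod_le _ _ _ _).trans ?_)
    rw [Nat.cast_add, Nat.cast_one, add_mul, one_mul, add_comm]
    gcongr

/-- An upper bound on the log-likelihood ratio alone suffices: `klFun` is nonnegative, so r log r +
1 - r is dominated by r |l| + 1, and integrability need not be assumed. -/
lemma klDiv_le_of_llr_le {μ ν : Measure α} [IsProbabilityMeasure μ] [IsProbabilityMeasure ν]
    (hac : μ ≪ ν) {l : α → ℝ} (hl : Integrable l μ) (hle : ∀ᵐ x ∂μ, llr μ ν x ≤ l x) :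
    klDiv μ ν ≤ ENNReal.ofReal (∫ x, l x ∂μ) := by
  have hint : Integrable (llr μ ν) μ := by
    rw [← integrable_klFun_rnDeriv_iff hac]
    have hdom : Integrable (fun x => (μ.rnDeriv ν x).toReal • |l x| + 1) ν :=
      ((integrable_rnDeriv_smul_iff hac).2 hl.abs).add (integrable_const _)
    refine hdom.mono' (Measurable.aestronglyMeasurable (by fun_prop)) ?_
    have hle' : ∀ᵐ x ∂ν, μ.rnDeriv ν x ≠ 0 → llr μ ν x ≤ l x := by
      rw [← Measure.withDensity_rnDeriv_eq _ _ hac] at hle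
      have := (ae_withDensity_iff (Measure.measurable_rnDeriv μ ν)).1 hle
      rwa [Measure.withDensity_rnDeriv_eq _ _ hac] at this
    filter_upwards [hle'] with x hx
    rw [Real.norm_of_nonneg (klFun_nonneg ENNReal.toReal_nonneg), klFun_apply]
    have h0 : (0 : ℝ) ≤ (μ.rnDeriv ν x).toReal := ENNReal.toReal_nonneg
    by_cases hz : μ.rnDeriv ν x = 0
    · simp [hz]
    · have := mul_le_mul_of_nonneg_left ((hx hz).trans (le_abs_self _)) h0
      simp only [llr_def] at this
      simp only [smul_eq_mul]
      linarith
  rw [klDiv_of_ac_of_integrable hac hint]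
  apply ENNReal.ofReal_le_ofReal
  simpa using integral_mono_ae hint hl hle

/-- The convex combination of two measures. -/
noncomputable def mix (t : ℝ) (μ ν : Measure α) : Measure α :=
  ENNReal.ofReal (1 - t) • μ + ENNReal.ofReal t • ν

lemma isProbabilityMeasure_mix {t : ℝ} (h0 : 0 ≤ t) (h1 : t ≤ 1) (μ ν : Measure α)
    [IsProbabilityMeasure μ] [IsProbabilityMeasure ν] : IsProbabilityMeasure (mix t μ ν) := by
  constructor
  simp only [mix, Measure.coe_add, Measure.coe_smul, Pi.add_apply, Pi.smul_apply, measure_univ,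
    smul_eq_mul, mul_one]
  rw [← ENNReal.ofReal_add (by linarith) h0]
  simp

lemma rnDeriv_mix {t : ℝ} (h0 : 0 ≤ t) (h1 : t ≤ 1) (μ ν : Measure α)
    [IsProbabilityMeasure μ] [IsProbabilityMeasure ν] :
    ∀ᵐ x ∂(mix t μ ν), (1 - t) * (μ.rnDeriv (mix t μ ν) x).toReal
      + t * (ν.rnDeriv (mix t μ ν) x).toReal = 1 := by
  have := isProbabilityMeasure_mix h0 h1 μ ν
  have hf1 : IsFiniteMeasure (ENNReal.ofReal (1 - t) • μ) :=
    Measure.smul_finite _ ENNReal.ofReal_ne_top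
  have hf2 : IsFiniteMeasure (ENNReal.ofReal t • ν) :=
    Measure.smul_finite _ ENNReal.ofReal_ne_top
  set ρ := mix t μ ν with hρ
  filter_upwards [Measure.rnDeriv_self ρ, Measure.rnDeriv_add (ENNReal.ofReal (1 - t) • μ)
    (ENNReal.ofReal t • ν) ρ, Measure.rnDeriv_smul_left_of_ne_top μ ρ
    (ENNReal.ofReal_ne_top (r := 1 - t)), Measure.rnDeriv_smul_left_of_ne_top ν ρ
    (ENNReal.ofReal_ne_top (r := t)), Measure.rnDeriv_ne_top μ ρ, Measure.rnDeriv_ne_top ν ρ]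
    with x e1 e2 e3 e4 e5 e6
  rw [Pi.add_apply, e3, e4, Pi.smul_apply, Pi.smul_apply, smul_eq_mul, smul_eq_mul] at e2
  have : (mix t μ ν).rnDeriv ρ x = 1 := e1
  rw [mix, e2] at this
  have h := congrArg ENNReal.toReal this
  rwa [ENNReal.toReal_add (ENNReal.mul_ne_top ENNReal.ofReal_ne_top e5)
    (ENNReal.mul_ne_top ENNReal.ofReal_ne_top e6), ENNReal.toReal_mul, ENNReal.toReal_mul,
    ENNReal.toReal_ofReal (by linarith), ENNReal.toReal_ofReal h0, ENNReal.toReal_one] at h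

lemma rnDeriv_toReal_pos {μ ν : Measure α} [IsProbabilityMeasure μ] [IsProbabilityMeasure ν]
    (h : μ ≪ ν) : ∀ᵐ x ∂μ, 0 < (μ.rnDeriv ν x).toReal := by
  filter_upwards [Measure.rnDeriv_pos h, h.ae_le (Measure.rnDeriv_lt_top μ ν)] with x h1 h2
  exact ENNReal.toReal_pos h1.ne' h2.ne

lemma llr_eq_add {μ ν ρ : Measure α} [IsProbabilityMeasure μ] [IsProbabilityMeasure ν]
    [IsProbabilityMeasure ρ] (h : μ ≪ ν) (h' : ν ≪ ρ) :
    ∀ᵐ x ∂μ, 0 < (μ.rnDeriv ρ x).toReal ∧ 0 < (ν.rnDeriv ρ x).toReal ∧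
      llr μ ρ x = llr μ ν x + Real.log (ν.rnDeriv ρ x).toReal := by
  filter_upwards [(h.trans h').ae_le (Measure.rnDeriv_mul_rnDeriv (κ := ρ) h),
    rnDeriv_toReal_pos (h.trans h'), rnDeriv_toReal_pos h,
    h.ae_le (rnDeriv_toReal_pos h')] with x e1 e2 e3 e4
  refine ⟨e2, e4, ?_⟩
  simp only [llr_def]
  rw [← e1, Pi.mul_apply, ENNReal.toReal_mul, Real.log_mul e3.ne' e4.ne']

lemma absolutelyContinuous_mix_left {t : ℝ} (h1 : t < 1) (μ ν : Measure α) : μ ≪ mix t μ ν := by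
  refine Measure.AbsolutelyContinuous.mk fun s _ hs => ?_
  simp only [mix, Measure.coe_add, Measure.coe_smul, Pi.add_apply, Pi.smul_apply, smul_eq_mul,
    add_eq_zero, mul_eq_zero, ENNReal.ofReal_eq_zero] at hs
  exact hs.1.resolve_left (by linarith)

lemma absolutelyContinuous_mix_right {t : ℝ} (h0 : 0 < t) (μ ν : Measure α) : ν ≪ mix t μ ν := by
  refine Measure.AbsolutelyContinuous.mk fun s _ hs => ?_
  simp only [mix, Measure.coe_add, Measure.coe_smul, Pi.add_apply, Pi.smul_apply, smul_eq_mul,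
    add_eq_zero, mul_eq_zero, ENNReal.ofReal_eq_zero] at hs
  exact hs.2.resolve_left (by linarith)

/-- The density of `ν` with respect to the mixture is at most 1 / (1 - t), which costs at most -log
(1 - t) in the log-likelihood ratio. -/
lemma klDiv_mix_le_add {t : ℝ} (h0 : 0 ≤ t) (h1 : t < 1) (μ ν ρ : Measure α)
    [IsProbabilityMeasure μ] [IsProbabilityMeasure ν] [IsProbabilityMeasure ρ] :
    klDiv μ (mix t ν ρ) ≤ klDiv μ ν + ENNReal.ofReal (-Real.log (1 - t)) := by
  by_cases htop : klDiv μ ν = ⊤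
  · simp [htop]
  obtain ⟨hac, hint⟩ := klDiv_ne_top_iff.1 htop
  have := isProbabilityMeasure_mix h0 h1.le ν ρ
  have hac' := absolutelyContinuous_mix_left h1 ν ρ
  have hlog : 0 ≤ -Real.log (1 - t) := by
    have := Real.log_nonpos (by linarith : 0 ≤ 1 - t) (by linarith)
    linarith
  have key : klDiv μ (mix t ν ρ) ≤ ENNReal.ofReal (∫ x, (llr μ ν x + -Real.log (1 - t)) ∂μ) := by
    refine klDiv_le_of_llr_le (hac.trans hac') (hint.add (integrable_const _)) ?_
    filter_upwards [llr_eq_add hac hac', (hac.trans hac').ae_le (rnDeriv_mix h0 h1.le ν ρ)]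
      with x ⟨_, e2, e3⟩ e4
    rw [e3, ← Real.log_inv]
    gcongr
    rw [← one_div, le_div_iff₀ (by linarith)]
    nlinarith [mul_nonneg h0 (ENNReal.toReal_nonneg (a := ρ.rnDeriv (mix t ν ρ) x))]
  refine key.trans ?_
  rw [integral_add hint (integrable_const _), klDiv_of_ac_of_integrable hac hint]
  simp only [integral_const, probReal_univ, one_smul, add_sub_cancel_right]
  exact ENNReal.ofReal_add_le

/-- Convexity of the divergence in its second argument. Pointwise, it is concavity of log applied to
the two densities with respect to the mixture, whose weighted average is 1. -/
lemma klDiv_self_mix_le {t : ℝ} (h0 : 0 < t) (h1 : t ≤ 1) (μ ν : Measure α)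
    [IsProbabilityMeasure μ] [IsProbabilityMeasure ν] :
    klDiv μ (mix t μ ν) ≤ ENNReal.ofReal t * klDiv μ ν := by
  by_cases htop : klDiv μ ν = ⊤
  · simp [htop, h0]
  obtain ⟨hac, hint⟩ := klDiv_ne_top_iff.1 htop
  have := isProbabilityMeasure_mix h0.le h1 μ ν
  have hac' := absolutelyContinuous_mix_right h0 μ ν
  have key : klDiv μ (mix t μ ν) ≤ ENNReal.ofReal (∫ x, t * llr μ ν x ∂μ) := by
    refine klDiv_le_of_llr_le (hac.trans hac') (hint.const_mul _) ?_
    filter_upwards [llr_eq_add hac hac', (hac.trans hac').ae_le (rnDeriv_mix h0.le h1 μ ν)]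
      with x ⟨e1, e2, e3⟩ e4
    have hc := strictConcaveOn_log_Ioi.concaveOn.2 (Set.mem_Ioi.2 e1) (Set.mem_Ioi.2 e2)
      (by linarith : 0 ≤ 1 - t) h0.le (by ring)
    simp only [smul_eq_mul] at hc
    rw [e4, Real.log_one] at hc
    simp only [llr_def] at e3 ⊢
    nlinarith
  refine key.trans ?_
  rw [integral_const_mul, ENNReal.ofReal_mul h0.le, klDiv_of_ac_of_integrable hac hint]
  simp

end InformationTheory

/-! ### The least divergence as a function of the mean level. -/

namespace CIWidth

open InformationTheory

/-- `M` is an affine functional on the convex family `P` that attains its maximum `b` over `P`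
at a member of `P`, and members of `P` at which `M` is close to `b` integrate a fixed nonnegative
function, which vanishes only at the maximizer, to a small number. -/
structure ExtremalFunctional (P : Set (ProbabilityMeasure ℝ)) (M : ProbabilityMeasure ℝ → ℝ)
    (b : ℝ) : Prop where
  mix_mem : ∀ κ ∈ P, ∀ ρ ∈ P, ∀ t : ℝ, 0 ≤ t → t ≤ 1 →
    ∃ σ ∈ P, (σ : Measure ℝ) = mix t (κ : Measure ℝ) ρ ∧ M σ = (1 - t) * M κ + t * M ρ
  attained : ∃ e ∈ P, M e = b
  le : ∀ κ ∈ P, M κ ≤ b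
  gap : ∃ g : ℝ → ENNReal, ∃ K : ℝ, 0 ≤ K ∧ Measurable g ∧ ∀ κ ∈ P,
    ∫⁻ x, g x ∂(κ : Measure ℝ) ≤ ENNReal.ofReal (K * (b - M κ)) ∧
      (∫⁻ x, g x ∂(κ : Measure ℝ) = 0 → M κ = b)

/-- The smallest divergence of `ν` from a member of `P` with `M` at least `x`. -/
noncomputable def klLevel (ν : ProbabilityMeasure ℝ) (P : Set (ProbabilityMeasure ℝ))
    (M : ProbabilityMeasure ℝ → ℝ) (x : ℝ) : ENNReal :=
  ⨅ κ ∈ {κ ∈ P | x ≤ M κ}, klDiv (ν : Measure ℝ) (κ : Measure ℝ)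

variable {ν : ProbabilityMeasure ℝ} {P : Set (ProbabilityMeasure ℝ)}
  {M : ProbabilityMeasure ℝ → ℝ} {b : ℝ}

lemma klLevel_le {κ : ProbabilityMeasure ℝ} (hκ : κ ∈ P) {x : ℝ} (hx : x ≤ M κ) :
    klLevel ν P M x ≤ klDiv (ν : Measure ℝ) κ :=
  iInf₂_le κ ⟨hκ, hx⟩

lemma le_klLevel {x : ℝ} {r : ENNReal}
    (h : ∀ κ ∈ P, x ≤ M κ → r ≤ klDiv (ν : Measure ℝ) κ) : r ≤ klLevel ν P M x :=
  le_iInf₂ fun κ hκ => h κ hκ.1 hκ.2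

lemma exists_of_klLevel_lt {x : ℝ} {r : ENNReal} (h : klLevel ν P M x < r) :
    ∃ κ ∈ P, x ≤ M κ ∧ klDiv (ν : Measure ℝ) κ < r := by
  simp only [klLevel, iInf_lt_iff] at h
  obtain ⟨κ, hκ, hlt⟩ := h
  exact ⟨κ, hκ.1, hκ.2, hlt⟩

lemma klLevel_mono : Monotone (klLevel ν P M) := fun _ _ hxy =>
  le_klLevel fun _ hκ hx => klLevel_le hκ (hxy.trans hx)

lemma klLevel_eq_zero (hν : ν ∈ P) {x : ℝ} (hx : x ≤ M ν) : klLevel ν P M x = 0 :=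
  le_antisymm ((klLevel_le hν hx).trans (by simp)) bot_le

namespace ExtremalFunctional

variable (hM : ExtremalFunctional P M b)
include hM

/-- Mix a competitor at level `x` with the maximizer of `M`. -/
lemma klLevel_mix_le {x t : ℝ} (h0 : 0 ≤ t) (h1 : t < 1) :
    klLevel ν P M ((1 - t) * x + t * b) ≤ klLevel ν P M x + ENNReal.ofReal (-Real.log (1 - t)) := by
  rw [← tsub_le_iff_right]
  refine le_klLevel fun κ hκ hx => ?_
  rw [tsub_le_iff_right]
  obtain ⟨e, he, rfl⟩ := hM.attained
  obtain ⟨σ, hσ, h2, h3⟩ := hM.mix_mem κ hκ e he t h0 h1.le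
  refine (klLevel_le hσ ?_).trans (h2 ▸ klDiv_mix_le_add h0 h1 _ _ _)
  rw [h3]
  have : 0 ≤ 1 - t := by linarith
  gcongr

/-- Mix a competitor at level `x` with `ν` itself. -/
lemma klLevel_mix_self_le (hν : ν ∈ P) {x t : ℝ} (h0 : 0 < t) (h1 : t ≤ 1) :
    klLevel ν P M ((1 - t) * M ν + t * x) ≤ ENNReal.ofReal t * klLevel ν P M x := by
  have ht : ENNReal.ofReal t ≠ 0 := by simpa using h0
  rw [← ENNReal.div_le_iff' ht ENNReal.ofReal_ne_top]
  refine le_klLevel fun κ hκ hx => ?_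
  rw [ENNReal.div_le_iff' ht ENNReal.ofReal_ne_top]
  obtain ⟨σ, hσ, h2, h3⟩ := hM.mix_mem ν hν κ hκ t h0.le h1
  refine (klLevel_le hσ ?_).trans (h2 ▸ klDiv_self_mix_le h0 h1 _ _)
  rw [h3]
  gcongr

/-- A modulus of continuity below `b`: the weight on the maximizer is chosen so that the mixed level
is exactly `y`. -/
lemma klLevel_le_add {x y : ℝ} (hxy : x ≤ y) (hy : y < b) :
    klLevel ν P M y ≤ klLevel ν P M x + ENNReal.ofReal (Real.log (b - x) - Real.log (b - y)) := by
  have hbx : 0 < b - x := by linarith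
  have hby : 0 < b - y := by linarith
  have h := hM.klLevel_mix_le (ν := ν) (x := x) (t := (y - x) / (b - x))
    (div_nonneg (by linarith) hbx.le) (by rw [div_lt_one hbx]; linarith)
  have e1 : 1 - (y - x) / (b - x) = (b - y) / (b - x) := by field_simp; ring
  have e2 : (1 - (y - x) / (b - x)) * x + (y - x) / (b - x) * b = y := by field_simp; ring
  rwa [e2, e1, Real.log_div hby.ne' hbx.ne', neg_sub] at h

lemma klLevel_ne_top (hν : ν ∈ P) {y : ℝ} (hy : y < b) : klLevel ν P M y ≠ ⊤ := by
  rcases le_total y (M ν) with h | h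
  · simp [klLevel_eq_zero hν h]
  · refine ne_top_of_le_ne_top ?_ (hM.klLevel_le_add h hy)
    simp [klLevel_eq_zero hν le_rfl]

lemma klLevel_lt_of_lt (hν : ν ∈ P) {x y r : ℝ} (hr : 0 < r) (hyx : y < x)
    (hx : klLevel ν P M x = ENNReal.ofReal r) : klLevel ν P M y < ENNReal.ofReal r := by
  rcases le_or_gt y (M ν) with h | h
  · simpa [klLevel_eq_zero hν h] using hr
  · have hd : 0 < x - M ν := by linarith
    have ht0 : 0 < (y - M ν) / (x - M ν) := div_pos (by linarith) hd
    have ht1 : (y - M ν) / (x - M ν) < 1 := by rw [div_lt_one hd]; linarith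
    have h1 := hM.klLevel_mix_self_le hν (x := x) ht0 ht1.le
    have e2 : (1 - (y - M ν) / (x - M ν)) * M ν + (y - M ν) / (x - M ν) * x = y := by
      field_simp; ring
    rw [e2, hx, ← ENNReal.ofReal_mul ht0.le] at h1
    refine h1.trans_lt ((ENNReal.ofReal_lt_ofReal_iff hr).2 ?_)
    exact mul_lt_of_lt_one_left hr ht1

/-- A law with `M` near `b` gives little mass to the set where the gap function is bounded away from
0, while `ν` gives it fixed positive mass. Donsker–Varadhan turns this contrast into arbitrarily
large divergence. -/
lemma exists_le_klLevel (hν : ν ∈ P) (hlt : M ν < b) (r : ℝ) :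
    ∃ x, M ν < x ∧ x < b ∧ ENNReal.ofReal r ≤ klLevel ν P M x := by
  obtain ⟨g, K, hK, hg, hgap⟩ := hM.gap
  have hne : ∫⁻ x, g x ∂(ν : Measure ℝ) ≠ 0 := fun h => hlt.ne ((hgap ν hν).2 h)
  obtain ⟨s, hs0, hs⟩ : ∃ s : ENNReal, s ≠ 0 ∧ s ≠ ⊤ ∧ (ν : Measure ℝ) {x | s ≤ g x} ≠ 0 := by
    by_contra! hcon
    refine hne ((lintegral_eq_zero_iff hg).2 ?_)
    have hn (n : ℕ) : ∀ᵐ x ∂(ν : Measure ℝ), ¬ ((n : ENNReal) + 1)⁻¹ ≤ g x := by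
      rw [ae_iff]
      simpa using hcon ((n : ENNReal) + 1)⁻¹ (by simp) (by simp)
    filter_upwards [ae_all_iff.2 hn] with x hx
    by_contra h0
    obtain ⟨n, hn⟩ := ENNReal.exists_inv_nat_lt h0
    refine hx n (le_trans (ENNReal.inv_le_inv.2 ?_) hn.le)
    exact le_self_add
  set A := {x | s ≤ g x} with hA
  have hAm : MeasurableSet A := measurableSet_le measurable_const hg
  have hpos : 0 < (ν : Measure ℝ).real A :=
    ENNReal.toReal_pos hs.2 (measure_ne_top _ _)
  -- Chosen so that t ν(A) - log 2 = |r|; the log 2 absorbs the log-moment term once κ(A) ≤ exp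
  -- (-t).
  set t := (|r| + Real.log 2) / (ν : Measure ℝ).real A with ht
  have hlog2 : 0 < Real.log 2 := Real.log_pos (by norm_num)
  have ht0 : 0 ≤ t := by positivity
  have hst : 0 < s.toReal := ENNReal.toReal_pos hs0 hs.1
  have hKs : 0 < (K + 1) / s.toReal := by positivity
  obtain ⟨x, hxν, hxb, hx⟩ : ∃ x, M ν < x ∧ x < b ∧
      (K + 1) / s.toReal * (b - x) ≤ Real.exp (-t) := by
    have hcont : Tendsto (fun x => (K + 1) / s.toReal * (b - x)) (𝓝[<] b) (𝓝 0) := by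
      have : Tendsto (fun x => (K + 1) / s.toReal * (b - x)) (𝓝 b)
          (𝓝 ((K + 1) / s.toReal * (b - b))) := Continuous.tendsto (by fun_prop) b
      rw [sub_self, mul_zero] at this
      exact this.mono_left nhdsWithin_le_nhds
    have h1 := hcont.eventually (ge_mem_nhds (Real.exp_pos (-t)))
    have h2 : ∀ᶠ x in 𝓝[<] b, x ∈ Set.Ioo (M ν) b := Ioo_mem_nhdsLT hlt
    obtain ⟨x, hx1, hx2⟩ := (h1.and h2).exists
    exact ⟨x, hx2.1, hx2.2, hx1⟩
  refine ⟨x, hxν, hxb, le_klLevel fun κ hκ hxκ => ?_⟩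
  by_cases htop : klDiv (ν : Measure ℝ) κ = ⊤
  · simp [htop]
  -- Markov's inequality for the gap function.
  have hmk : s * (κ : Measure ℝ) A ≤ ENNReal.ofReal (K * (b - M κ)) :=
    (mul_meas_ge_le_lintegral hg s).trans (hgap κ hκ).1
  have hmr : s.toReal * (κ : Measure ℝ).real A ≤ K * (b - M κ) := by
    have := ENNReal.toReal_mono ENNReal.ofReal_ne_top hmk
    rwa [ENNReal.toReal_mul, ENNReal.toReal_ofReal
      (mul_nonneg hK (sub_nonneg.2 (hM.le κ hκ)))] at this
  have hκA : (κ : Measure ℝ).real A ≤ Real.exp (-t) := by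
    refine le_trans ?_ hx
    rw [div_mul_eq_mul_div, le_div_iff₀ hst]
    have h1 : K * (b - M κ) ≤ K * (b - x) := by gcongr
    nlinarith
  have hdv := mul_measureReal_le_toReal_klDiv_add_log (ν : Measure ℝ) κ htop hAm t
  have hlog : Real.log (1 + (Real.exp t - 1) * (κ : Measure ℝ).real A) ≤ Real.log 2 := by
    have h1 : 0 ≤ Real.exp t - 1 := by linarith [Real.one_le_exp ht0]
    have h3 : 0 ≤ (κ : Measure ℝ).real A := measureReal_nonneg
    have h2 : (Real.exp t - 1) * (κ : Measure ℝ).real A ≤ 1 := by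
      have h4 : Real.exp t * Real.exp (-t) = 1 := by rw [← Real.exp_add]; simp
      nlinarith [mul_le_mul_of_nonneg_left hκA (Real.exp_pos t).le]
    apply Real.log_le_log
    · nlinarith [mul_nonneg h1 h3]
    · linarith
  have hta : t * (ν : Measure ℝ).real A = |r| + Real.log 2 := by
    rw [ht]; field_simp
  apply ENNReal.ofReal_le_of_le_toReal
  linarith [le_abs_self r]

lemma exists_klLevel_eq (hν : ν ∈ P) (hlt : M ν < b) {r : ℝ} (hr : 0 < r) :
    ∃ x, M ν < x ∧ klLevel ν P M x = ENNReal.ofReal r := by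
  obtain ⟨c, hc, hcb, hrc⟩ := hM.exists_le_klLevel hν hlt r
  have hfin {y : ℝ} (hy : y < b) := hM.klLevel_ne_top hν hy
  have hmono {x y : ℝ} (hxy : x ≤ y) (hy : y < b) :
      (klLevel ν P M x).toReal ≤ (klLevel ν P M y).toReal :=
    ENNReal.toReal_mono (hfin hy) (klLevel_mono hxy)
  have hinc {x y : ℝ} (hxy : x ≤ y) (hy : y < b) : (klLevel ν P M y).toReal ≤
      (klLevel ν P M x).toReal + (Real.log (b - x) - Real.log (b - y)) := by
    have h := ENNReal.toReal_mono (by simp [hfin (hxy.trans_lt hy)])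
      (hM.klLevel_le_add (ν := ν) hxy hy)
    rwa [ENNReal.toReal_add (hfin (hxy.trans_lt hy)) (by simp), ENNReal.toReal_ofReal] at h
    have := Real.log_le_log (by linarith : 0 < b - y) (by linarith : b - y ≤ b - x)
    linarith
  have hcont : ContinuousOn (fun x => (klLevel ν P M x).toReal) (Set.Icc (M ν) c) := by
    intro x hx
    apply ContinuousAt.continuousWithinAt
    have hxb : x < b := hx.2.trans_lt hcb
    have hlog : Tendsto (fun y => |Real.log (b - y) - Real.log (b - x)|) (𝓝 x) (𝓝 0) := by
      have : ContinuousAt (fun y => |Real.log (b - y) - Real.log (b - x)|) x := by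
        have : b - x ≠ 0 := by linarith
        fun_prop (disch := assumption)
      simpa [ContinuousAt] using this
    rw [ContinuousAt, tendsto_iff_dist_tendsto_zero]
    refine squeeze_zero' (Eventually.of_forall fun _ => dist_nonneg) ?_ hlog
    filter_upwards [Iio_mem_nhds hxb] with y hy
    rw [Real.dist_eq, abs_le]
    rcases le_total x y with h | h
    · have h1 := hmono h hy
      have h2 := hinc h hy
      constructor <;> cases abs_cases (Real.log (b - y) - Real.log (b - x)) <;> linarith
    · have h1 := hmono h hxb
      have h2 := hinc h hxb
      constructor <;> cases abs_cases (Real.log (b - y) - Real.log (b - x)) <;> linarith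
  have hivt := intermediate_value_Icc hc.le hcont
  have hrmem : r ∈ Set.Icc (klLevel ν P M (M ν)).toReal (klLevel ν P M c).toReal := by
    constructor
    · simp [klLevel_eq_zero hν le_rfl, hr.le]
    · exact (ENNReal.ofReal_le_iff_le_toReal (hfin hcb)).1 hrc
  obtain ⟨x, hx, hxr⟩ := hivt hrmem
  simp only at hxr
  refine ⟨x, lt_of_le_of_ne hx.1 ?_, ?_⟩
  · rintro rfl
    simp [klLevel_eq_zero hν le_rfl] at hxr
    exact hr.ne hxr
  · rw [← hxr, ENNReal.ofReal_toReal (hfin (hx.2.trans_lt hcb))]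

lemma klLevel_injective (hν : ν ∈ P) {r x y : ℝ} (hr : 0 < r)
    (hx : klLevel ν P M x = ENNReal.ofReal r) (hy : klLevel ν P M y = ENNReal.ofReal r) :
    x = y := by
  rcases lt_trichotomy x y with h | h | h
  · exact absurd hx (hM.klLevel_lt_of_lt hν hr h hy).ne
  · exact h
  · exact absurd hy (hM.klLevel_lt_of_lt hν hr h hx).ne

end ExtremalFunctional

end CIWidth

/-! ### Both families are extremal for the mean and its negative. -/

namespace CIWidth

open InformationTheory

lemma integral_mix {f : ℝ → ℝ} {κ ρ : Measure ℝ} (hκ : Integrable f κ) (hρ : Integrable f ρ)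
    {t : ℝ} (h0 : 0 ≤ t) (h1 : t ≤ 1) :
    ∫ x, f x ∂(mix t κ ρ) = (1 - t) * ∫ x, f x ∂κ + t * ∫ x, f x ∂ρ := by
  rw [mix, integral_add_measure (hκ.smul_measure ENNReal.ofReal_ne_top)
    (hρ.smul_measure ENNReal.ofReal_ne_top), integral_smul_measure, integral_smul_measure,
    ENNReal.toReal_ofReal (by linarith), ENNReal.toReal_ofReal h0, smul_eq_mul, smul_eq_mul]

/-- The convex combination of two probability measures. -/
noncomputable def mixProb (t : ℝ) (h0 : 0 ≤ t) (h1 : t ≤ 1) (κ ρ : ProbabilityMeasure ℝ) :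
    ProbabilityMeasure ℝ :=
  ⟨mix t κ ρ, isProbabilityMeasure_mix h0 h1 _ _⟩

lemma mean_mixProb {t : ℝ} (h0 : 0 ≤ t) (h1 : t ≤ 1) {κ ρ : ProbabilityMeasure ℝ}
    (hκ : Integrable (fun x : ℝ => x) (κ : Measure ℝ))
    (hρ : Integrable (fun x : ℝ => x) (ρ : Measure ℝ)) :
    mean (mixProb t h0 h1 κ ρ) = (1 - t) * mean κ + t * mean ρ :=
  integral_mix hκ hρ h0 h1

lemma mean_dirac (a : ℝ) :
    mean ⟨Measure.dirac a, Measure.dirac.isProbabilityMeasure⟩ = a :=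
  integral_dirac (fun x : ℝ => x) a

/-- A signed mean is extremal as soon as some nonnegative function, vanishing only at the extremal
point, has an integral that is bounded by the distance to the extremal value. -/
lemma ExtremalFunctional.of_integrable {P : Set (ProbabilityMeasure ℝ)} {s b K : ℝ} (hK : 0 < K)
    (hint : ∀ κ ∈ P, Integrable (fun x : ℝ => x) (κ : Measure ℝ))
    (hmix : ∀ κ ∈ P, ∀ ρ ∈ P, ∀ (t : ℝ) (h0 : 0 ≤ t) (h1 : t ≤ 1), mixProb t h0 h1 κ ρ ∈ P)
    (hatt : ∃ e ∈ P, s * mean e = b) {f : ℝ → ℝ} (hf : Measurable f)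
    (hfint : ∀ κ ∈ P, Integrable f (κ : Measure ℝ))
    (hf0 : ∀ κ ∈ P, ∀ᵐ x ∂(κ : Measure ℝ), 0 ≤ f x)
    (hfs : ∀ x, f x = 0 → s * x = b)
    (hfle : ∀ κ ∈ P, ∫ x, f x ∂(κ : Measure ℝ) ≤ K * (b - s * mean κ)) :
    ExtremalFunctional P (fun κ => s * mean κ) b where
  mix_mem κ hκ ρ hρ t h0 h1 := by
    refine ⟨mixProb t h0 h1 κ ρ, hmix κ hκ ρ hρ t h0 h1, rfl, ?_⟩
    rw [mean_mixProb h0 h1 (hint κ hκ) (hint ρ hρ)]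
    ring
  attained := hatt
  le κ hκ := by
    have h1 := (integral_nonneg_of_ae (hf0 κ hκ)).trans (hfle κ hκ)
    have := nonneg_of_mul_nonneg_right h1 hK
    linarith
  gap := by
    refine ⟨fun x => ENNReal.ofReal (f x), K, hK.le, hf.ennreal_ofReal, fun κ hκ => ⟨?_, fun h => ?_⟩⟩
    · rw [← ofReal_integral_eq_lintegral_ofReal (hfint κ hκ) (hf0 κ hκ)]
      exact ENNReal.ofReal_le_ofReal (hfle κ hκ)
    · rw [lintegral_eq_zero_iff hf.ennreal_ofReal] at h
      have hb : ∀ᵐ x ∂(κ : Measure ℝ), s * x = b := by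
        filter_upwards [h, hf0 κ hκ] with x h1 h2
        exact hfs x (le_antisymm (ENNReal.ofReal_eq_zero.1 h1) h2)
      change s * ∫ x, x ∂(κ : Measure ℝ) = b
      rw [← integral_const_mul, integral_congr_ae hb]
      simp

lemma integrable_of_mem_boundedFamily {κ : ProbabilityMeasure ℝ} (hκ : κ ∈ boundedFamily) :
    Integrable (fun x : ℝ => x) (κ : Measure ℝ) := by
  refine Integrable.of_bound (C := 1) (by fun_prop) ?_
  filter_upwards [show ∀ᵐ x ∂(κ : Measure ℝ), x ∈ Set.Icc (0 : ℝ) 1 from hκ] with x hx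
  rw [Real.norm_of_nonneg hx.1]
  exact hx.2

lemma extremalFunctional_boundedFamily {s b a : ℝ} (ha : a ∈ Set.Icc (0 : ℝ) 1) (hab : s * a = b)
    (hle : ∀ x ∈ Set.Icc (0 : ℝ) 1, s * x ≤ b) :
    ExtremalFunctional boundedFamily (fun κ => s * mean κ) b := by
  have hint (κ) (hκ : κ ∈ boundedFamily) : Integrable (fun x : ℝ => b - s * x) (κ : Measure ℝ) :=
    (integrable_const b).sub ((integrable_of_mem_boundedFamily hκ).const_mul s)
  refine ExtremalFunctional.of_integrable (K := 1) (f := fun x => b - s * x) one_pos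
    (fun κ => integrable_of_mem_boundedFamily) ?_ ?_ (by fun_prop) hint ?_ ?_ ?_
  · intro κ hκ ρ hρ t h0 h1
    change ∀ᵐ x ∂(mix t (κ : Measure ℝ) ρ), _
    rw [mix, ae_add_measure_iff]
    exact ⟨Measure.ae_smul_measure hκ _, Measure.ae_smul_measure hρ _⟩
  · refine ⟨⟨Measure.dirac a, Measure.dirac.isProbabilityMeasure⟩, ?_, ?_⟩
    · exact (ae_dirac_iff (p := (· ∈ Set.Icc (0 : ℝ) 1)) measurableSet_Icc).2 ha
    · rw [mean_dirac, hab]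
  · intro κ hκ
    filter_upwards [show ∀ᵐ x ∂(κ : Measure ℝ), x ∈ Set.Icc (0 : ℝ) 1 from hκ] with x hx
    exact sub_nonneg.2 (hle x hx)
  · intro x hx
    linarith
  · intro κ hκ
    rw [integral_sub (integrable_const b) ((integrable_of_mem_boundedFamily hκ).const_mul s),
      integral_const_mul]
    simp [mean]

section momentFamily

variable {ε Γ : ℝ}

lemma integrable_rpow_of_mem_momentFamily {κ : ProbabilityMeasure ℝ}
    (hκ : κ ∈ momentFamily ε Γ) :
    Integrable (fun x : ℝ => |x| ^ (1 + ε)) (κ : Measure ℝ) := by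
  refine ⟨Measurable.aestronglyMeasurable (by fun_prop), ?_⟩
  rw [hasFiniteIntegral_iff_ofReal (Eventually.of_forall fun x => by positivity)]
  exact (show _ ≤ ENNReal.ofReal Γ from hκ).trans_lt ENNReal.ofReal_lt_top

lemma integral_rpow_le_of_mem_momentFamily (hΓ : 0 < Γ) {κ : ProbabilityMeasure ℝ}
    (hκ : κ ∈ momentFamily ε Γ) : ∫ x : ℝ, |x| ^ (1 + ε) ∂(κ : Measure ℝ) ≤ Γ := by
  rw [integral_eq_lintegral_of_nonneg_ae (Eventually.of_forall fun x => by positivity)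
    (Measurable.aestronglyMeasurable (by fun_prop))]
  exact ENNReal.toReal_le_of_le_ofReal hΓ.le hκ

lemma integrable_of_mem_momentFamily (hε : 0 < ε) {κ : ProbabilityMeasure ℝ}
    (hκ : κ ∈ momentFamily ε Γ) : Integrable (fun x : ℝ => x) (κ : Measure ℝ) := by
  refine ((integrable_const (1 : ℝ)).add (integrable_rpow_of_mem_momentFamily hκ)).mono'
    (by fun_prop) (Eventually.of_forall fun x => ?_)
  rw [Real.norm_eq_abs, Pi.add_apply]
  rcases le_total |x| 1 with h | h
  · linarith [Real.rpow_nonneg (abs_nonneg x) (1 + ε)]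
  · have := Real.rpow_le_rpow_of_exponent_le h (by linarith : (1 : ℝ) ≤ 1 + ε)
    rw [Real.rpow_one] at this
    linarith

/-- The strict tangent line inequality for `y ↦ |y| ^ p` at `m > 0`. -/
lemma tangent_lt_abs_rpow {p m y : ℝ} (hp : 1 < p) (hm : 0 < m) (hy : y ≠ m) :
    m ^ p + p * m ^ (p - 1) * (y - m) < |y| ^ p := by
  have hmp : m ^ p = m ^ (p - 1) * m := by
    rw [← Real.rpow_add_one hm.ne']
    ring_nf
  have hpos : 0 < m ^ p := Real.rpow_pos_of_pos hm p
  have hline : m ^ p + p * m ^ (p - 1) * (y - m) = m ^ p * (1 + p * (y / m - 1)) := by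
    rw [hmp]
    field_simp
  rw [hline]
  rcases le_or_gt 0 y with h0 | h0
  · have hlt := one_add_mul_self_lt_rpow_one_add (s := y / m - 1) (by
      have : 0 ≤ y / m := by positivity
      linarith) (by
      intro h
      apply hy
      have : y / m = 1 := by linarith
      rwa [div_eq_one_iff_eq hm.ne'] at this) hp
    calc m ^ p * (1 + p * (y / m - 1)) < m ^ p * (1 + (y / m - 1)) ^ p := by gcongr
      _ = |y| ^ p := by
        rw [abs_of_nonneg h0, ← Real.mul_rpow hm.le (by
          have : 0 ≤ y / m := by positivity
          linarith)]
        congr 1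
        field_simp
        ring
  -- Bernoulli is unavailable for negative `y`, but there the tangent line is already negative since
  -- p > 1.
  · have h1 : y / m < 0 := div_neg_of_neg_of_pos h0 hm
    have h2 : 1 + p * (y / m - 1) < 0 := by nlinarith
    exact (mul_neg_of_pos_of_neg hpos h2).trans_le (by positivity)

/-- The gap function is |x|^(1+ε) minus its tangent line at `m`, evaluated at `s * x`. Since m^(1+ε)
= Γ, the moment constraint bounds its integral by the tangent slope times m - s · mean. -/
lemma extremalFunctional_momentFamily (hε : 0 < ε) (hΓ : 0 < Γ) {s : ℝ} (hs : |s| = 1) :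
    ExtremalFunctional (momentFamily ε Γ) (fun κ => s * mean κ) (Γ ^ (1 + ε)⁻¹) := by
  set m := Γ ^ (1 + ε)⁻¹ with hm_def
  have hm : 0 < m := Real.rpow_pos_of_pos hΓ _
  have hmΓ : m ^ (1 + ε) = Γ := Real.rpow_inv_rpow hΓ.le (by linarith)
  have hss : s * s = 1 := by rw [← abs_mul_abs_self, hs, one_mul]
  have habs (x : ℝ) : |s * x| = |x| := by rw [abs_mul, hs, one_mul]
  set f : ℝ → ℝ := fun x =>
    |x| ^ (1 + ε) - (m ^ (1 + ε) + (1 + ε) * m ^ (1 + ε - 1) * (s * x - m)) with hf_def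
  have hid {κ : ProbabilityMeasure ℝ} (hκ : κ ∈ momentFamily ε Γ) :=
    integrable_of_mem_momentFamily hε hκ
  have hlin {κ : ProbabilityMeasure ℝ} (hκ : κ ∈ momentFamily ε Γ) : Integrable (fun x : ℝ =>
      (1 + ε) * m ^ (1 + ε - 1) * (s * x - m)) (κ : Measure ℝ) :=
    (((hid hκ).const_mul s).sub (integrable_const m)).const_mul _
  refine ExtremalFunctional.of_integrable (K := (1 + ε) * m ^ (1 + ε - 1)) (f := f) (by positivity)
    (fun κ => hid) ?_ ?_ (by fun_prop) ?_ ?_ ?_ ?_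
  · intro κ hκ ρ hρ t h0 h1
    change ∫⁻ x, _ ∂(mix t (κ : Measure ℝ) ρ) ≤ _
    rw [mix, lintegral_add_measure, lintegral_smul_measure, lintegral_smul_measure]
    calc _ ≤ ENNReal.ofReal (1 - t) • ENNReal.ofReal Γ + ENNReal.ofReal t • ENNReal.ofReal Γ := by
          gcongr
          exacts [hκ, hρ]
      _ = ENNReal.ofReal Γ := by
          rw [← add_smul, ← ENNReal.ofReal_add (by linarith) h0]
          simp
  · refine ⟨⟨Measure.dirac (s * m), Measure.dirac.isProbabilityMeasure⟩, ?_, ?_⟩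
    · change ∫⁻ x, _ ∂(Measure.dirac (s * m)) ≤ _
      rw [lintegral_dirac' _ (by fun_prop), habs, abs_of_pos hm, hmΓ]
    · rw [mean_dirac, ← mul_assoc, hss, one_mul]
  · intro κ hκ
    exact (integrable_rpow_of_mem_momentFamily hκ).sub ((integrable_const _).add (hlin hκ))
  · intro κ _
    refine Eventually.of_forall fun x => ?_
    rcases eq_or_ne (s * x) m with h | h
    · simp only [hf_def]
      rw [h, ← habs, h, abs_of_pos hm]
      simp
    · have := tangent_lt_abs_rpow (by linarith : 1 < 1 + ε) hm h
      rw [habs] at this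
      exact (sub_pos.2 this).le
  · intro x hx
    by_contra h
    have := tangent_lt_abs_rpow (by linarith : 1 < 1 + ε) hm h
    rw [habs] at this
    simp only [hf_def] at hx
    linarith
  · intro κ hκ
    have h1 : ∫ x, f x ∂(κ : Measure ℝ) = ∫ x : ℝ, |x| ^ (1 + ε) ∂(κ : Measure ℝ) -
        (m ^ (1 + ε) + (1 + ε) * m ^ (1 + ε - 1) * (s * mean κ - m)) := by
      have hline : Integrable (fun x => m ^ (1 + ε) + (1 + ε) * m ^ (1 + ε - 1) * (s * x - m))
        (κ : Measure ℝ) := (integrable_const _).add (hlin hκ)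
      simp only [hf_def]
      rw [integral_sub (integrable_rpow_of_mem_momentFamily hκ) hline, integral_add (integrable_const _) (hlin hκ),
        integral_const_mul, integral_sub ((hid hκ).const_mul s) (integrable_const _),
        integral_const_mul]
      simp [mean]
    rw [h1, hmΓ]
    linarith [integral_rpow_le_of_mem_momentFamily hΓ hκ]

end momentFamily

lemma exists_extremalFunctional {P : Set (ProbabilityMeasure ℝ)}
    (hP : P = boundedFamily ∨ ∃ ε Γ : ℝ, 0 < ε ∧ 0 < Γ ∧ P = momentFamily ε Γ) :
    ∃ a b : ℝ, ExtremalFunctional P (fun κ => -1 * mean κ) (-a) ∧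
      ExtremalFunctional P (fun κ => 1 * mean κ) b := by
  rcases hP with rfl | ⟨ε, Γ, hε, hΓ, rfl⟩
  · exact ⟨0, 1, extremalFunctional_boundedFamily (a := 0) (by simp) (by simp)
      fun x hx => by linarith [hx.1],
      extremalFunctional_boundedFamily (a := 1) (by simp) (by simp) fun x hx => by linarith [hx.2]⟩
  · refine ⟨-Γ ^ (1 + ε)⁻¹, Γ ^ (1 + ε)⁻¹, ?_, extremalFunctional_momentFamily hε hΓ (by simp)⟩
    rw [neg_neg]
    exact extremalFunctional_momentFamily hε hΓ (by simp)

lemma maxMean_eq {P : Set (ProbabilityMeasure ℝ)} {b : ℝ}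
    (h : ExtremalFunctional P (fun κ => 1 * mean κ) b) : maxMean P = b := by
  obtain ⟨e, he, heb⟩ := h.attained
  refine le_antisymm (iSup₂_le fun κ hκ => ?_) ?_
  · simpa using h.le κ hκ
  · rw [← heb, one_mul]
    exact le_iSup₂ (f := fun κ (_ : κ ∈ P) => (mean κ : EReal)) e he

lemma minMean_eq {P : Set (ProbabilityMeasure ℝ)} {a : ℝ}
    (h : ExtremalFunctional P (fun κ => -1 * mean κ) (-a)) : minMean P = a := by
  obtain ⟨e, he, hea⟩ := h.attained
  refine le_antisymm ?_ (le_iInf₂ fun κ hκ => ?_)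
  · have : a = mean e := by linarith
    rw [this]
    exact iInf₂_le (f := fun κ (_ : κ ∈ P) => (mean κ : EReal)) e he
  · have := h.le κ hκ
    exact EReal.coe_le_coe_iff.2 (by linarith)

lemma klInf_eq_klLevel_of_ge {ν : ProbabilityMeasure ℝ} {P : Set (ProbabilityMeasure ℝ)} {x : ℝ}
    (h : mean ν ≤ x) : klInf ν P x = klLevel ν P (fun κ => 1 * mean κ) x := by
  simp [klInf, klLevel, h]

lemma klInf_eq_klLevel_of_lt {ν : ProbabilityMeasure ℝ} {P : Set (ProbabilityMeasure ℝ)} {x : ℝ}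
    (h : x < mean ν) : klInf ν P x = klLevel ν P (fun κ => -1 * mean κ) (-x) := by
  simp [klInf, klLevel, not_le.2 h]

end CIWidth

/-! ### Number of samples and change of measure. -/

namespace CIWidth

open InformationTheory

instance (ν 𝒞 : ProbabilityMeasure ℝ) : IsProbabilityMeasure (envLaw ν 𝒞) := by
  unfold envLaw
  infer_instance

section numSamples

/-- In ℕ the supremum of an empty or unbounded set is 0, so a positive value is an attained maximum.
-/
lemma numSamples_spec {C : ℝ} {c : ℕ → ℝ} (h : 0 < numSamples C c) :
    ∑ i ∈ Finset.range (numSamples C c), c i ≤ C ∧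
      ∀ m, numSamples C c < m → C < ∑ i ∈ Finset.range m, c i := by
  have hne : {n : ℕ | 0 < n ∧ ∑ i ∈ Finset.range n, c i ≤ C}.Nonempty := by
    by_contra hcon
    rw [numSamples, Set.not_nonempty_iff_eq_empty.1 hcon] at h
    simp at h
  have hbdd : BddAbove {n : ℕ | 0 < n ∧ ∑ i ∈ Finset.range n, c i ≤ C} := by
    by_contra hcon
    rw [numSamples, Nat.sSup_of_not_bddAbove hcon] at h
    simp at h
  refine ⟨(Nat.sSup_mem hne hbdd).2, fun m hm => ?_⟩
  by_contra! hcon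
  exact (le_csSup hbdd ⟨(Nat.zero_le _).trans_lt hm, hcon⟩).not_gt hm

lemma numSamples_eq {C : ℝ} {c : ℕ → ℝ} {n : ℕ} (hn : 0 < n)
    (h : ∑ i ∈ Finset.range n, c i ≤ C ∧ ∀ m, n < m → C < ∑ i ∈ Finset.range m, c i) :
    numSamples C c = n := by
  refine IsGreatest.csSup_eq ⟨⟨hn, h.1⟩, fun m hm => ?_⟩
  by_contra! hcon
  exact (h.2 m hcon).not_ge hm.2

lemma measurable_numSamples (C : ℝ) : Measurable (numSamples C) := by
  refine measurable_of_Ioi fun k => ?_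
  have : numSamples C ⁻¹' Set.Ioi k = ⋃ n ∈ Set.Ioi k,
      ({c | ∑ i ∈ Finset.range n, c i ≤ C} ∩
        ⋂ m ∈ Set.Ioi n, {c | C < ∑ i ∈ Finset.range m, c i}) := by
    ext c
    simp only [Set.mem_preimage, Set.mem_Ioi, Set.mem_iUnion, Set.mem_inter_iff, Set.mem_ofPred_eq,
      Set.mem_iInter, exists_prop]
    constructor
    · intro h
      exact ⟨numSamples C c, h, numSamples_spec (by omega)⟩
    · rintro ⟨n, hn, h⟩
      rwa [numSamples_eq (by omega) h]
  rw [this]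
  refine MeasurableSet.biUnion (Set.to_countable _) fun n _ => MeasurableSet.inter ?_ ?_
  · exact measurableSet_le (by fun_prop) measurable_const
  · exact MeasurableSet.biInter (Set.to_countable _) fun m _ =>
      measurableSet_lt measurable_const (by fun_prop)

lemma measurable_comp_numSamples {F : (n : ℕ) → (Fin n → ℝ) → EReal} (hF : ∀ n, Measurable (F n))
    (C : ℝ) : Measurable fun ω : (ℕ → ℝ) × (ℕ → ℝ) => F (numSamples C ω.2) fun i => ω.1 i := by
  have h : Measurable fun p : ℕ × (ℕ → ℝ) => F p.1 fun i => p.2 i :=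
    measurable_from_prod_countable_right fun n => (hF n).comp (by fun_prop)
  exact h.comp (((measurable_numSamples C).comp measurable_snd).prodMk measurable_fst)

lemma Policy.measurable_lowerAt (π : Policy) (C δ : ℝ) : Measurable (π.lowerAt C δ) :=
  measurable_comp_numSamples (fun n => π.measurable_lower n δ) C

lemma Policy.measurable_upperAt (π : Policy) (C δ : ℝ) : Measurable (π.upperAt C δ) :=
  measurable_comp_numSamples (fun n => π.measurable_upper n δ) C

/-- The event that the reported interval contains the point `m`. -/
def Policy.coverSet (π : Policy) (C δ m : ℝ) : Set ((ℕ → ℝ) × (ℕ → ℝ)) :=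
  {ω | (m : EReal) ∈ Set.Icc (π.lowerAt C δ ω) (π.upperAt C δ ω)}

lemma Policy.measurableSet_coverSet (π : Policy) (C δ m : ℝ) :
    MeasurableSet (π.coverSet C δ m) :=
  (measurableSet_le (π.measurable_lowerAt C δ) measurable_const).inter
    (measurableSet_le measurable_const (π.measurable_upperAt C δ))

lemma mean_pos {𝒞 : ProbabilityMeasure ℝ} (hpos : ∀ᵐ c ∂(𝒞 : Measure ℝ), 0 < c)
    (hint : Integrable (fun c : ℝ => c) (𝒞 : Measure ℝ)) : 0 < mean 𝒞 := by
  refine lt_of_le_of_ne (integral_nonneg_of_ae (hpos.mono fun _ h => h.le)) fun h => ?_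
  have h0 := (integral_eq_zero_iff_of_nonneg_ae (hpos.mono fun _ h => h.le) hint).1 h.symm
  have : ∀ᵐ _ ∂(𝒞 : Measure ℝ), False := by
    filter_upwards [hpos, h0] with x h1 h2
    exact h1.ne' h2
  exact this.exists.elim fun _ h => h

/-- Buying more than ⌈θC⌉ samples forces the average of the first ⌈θC⌉ + 1 costs to be at most 1/θ,
strictly below the mean cost; the law of large numbers makes this unlikely. -/
lemma tendsto_lt_numSamples {𝒞 : ProbabilityMeasure ℝ} (hpos : ∀ᵐ c ∂(𝒞 : Measure ℝ), 0 < c)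
    (hint : Integrable (fun c : ℝ => c) (𝒞 : Measure ℝ)) {θ : ℝ} (hθ : 0 < θ)
    (hθ' : 1 < θ * mean 𝒞) :
    Tendsto (fun C : ℝ => Measure.infinitePi (fun _ : ℕ => (𝒞 : Measure ℝ))
      {c | ⌈θ * C⌉₊ < numSamples C c}) atTop (𝓝 0) := by
  set μ := Measure.infinitePi fun _ : ℕ => (𝒞 : Measure ℝ) with hμ
  have hmp (i : ℕ) : MeasurePreserving (fun c : ℕ → ℝ => c i) μ (𝒞 : Measure ℝ) :=
    measurePreserving_eval_infinitePi _ i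
  have hmean : ∫ c, c 0 ∂μ = mean 𝒞 := by
    have h := integral_map (μ := μ) (hmp 0).measurable.aemeasurable (f := fun x : ℝ => x)
      aestronglyMeasurable_id
    rw [(hmp 0).map_eq] at h
    exact h.symm
  have hslln : ∀ᵐ c : ℕ → ℝ ∂μ, Tendsto (fun n : ℕ => (∑ i ∈ Finset.range n, c i) / (n : ℝ))
      atTop (𝓝 (mean 𝒞)) := by
    rw [← hmean]
    refine ProbabilityTheory.strong_law_ae_real (fun i (c : ℕ → ℝ) => c i)
      ((hmp 0).integrable_comp_of_integrable hint) (fun i j hij => ?_) fun i => ?_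
    · exact (ProbabilityTheory.iIndepFun_infinitePi (P := fun _ : ℕ => (𝒞 : Measure ℝ))
        (X := fun _ x => x) fun _ => measurable_id).indepFun hij
    · exact ⟨(hmp i).measurable.aemeasurable, (hmp 0).measurable.aemeasurable,
        by rw [(hmp i).map_eq, (hmp 0).map_eq]⟩
  have hprob : TendstoInMeasure μ
      (fun (n : ℕ) (c : ℕ → ℝ) => (∑ i ∈ Finset.range n, c i) / (n : ℝ)) atTop
      fun _ => mean 𝒞 :=
    tendstoInMeasure_of_tendsto_ae
      (fun n => (Measurable.aestronglyMeasurable (by fun_prop))) hslln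
  have hmeas := tendstoInMeasure_iff_dist.1 hprob (mean 𝒞 - 1 / θ)
    (by rw [sub_pos, div_lt_iff₀ hθ]; linarith)
  have hN : Tendsto (fun C : ℝ => ⌈θ * C⌉₊ + 1) atTop atTop :=
    (tendsto_add_atTop_nat 1).comp
      (tendsto_nat_ceil_atTop.comp (tendsto_id.const_mul_atTop hθ))
  refine tendsto_of_tendsto_of_tendsto_of_le_of_le tendsto_const_nhds (hmeas.comp hN)
    (fun _ => bot_le) fun C => ?_
  refine measure_mono_ae ?_
  have hall : ∀ᵐ c ∂μ, ∀ i : ℕ, 0 < c i :=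
    ae_all_iff.2 fun i => (hmp i).quasiMeasurePreserving.ae hpos
  filter_upwards [hall] with c hc hlt
  change mean 𝒞 - 1 / θ ≤ dist _ _
  have hle : ∑ i ∈ Finset.range (⌈θ * C⌉₊ + 1), c i ≤ C :=
    (Finset.sum_le_sum_of_subset_of_nonneg (Finset.range_mono hlt) fun i _ _ => (hc i).le).trans
      (numSamples_spec ((Nat.zero_le _).trans_lt hlt)).1
  have hceil : θ * C ≤ ((⌈θ * C⌉₊ + 1 : ℕ) : ℝ) := by
    push_cast
    linarith [Nat.le_ceil (θ * C)]
  have hdiv : (∑ i ∈ Finset.range (⌈θ * C⌉₊ + 1), c i) / ((⌈θ * C⌉₊ + 1 : ℕ) : ℝ) ≤ 1 / θ := by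
    rw [div_le_div_iff₀ (by positivity) hθ]
    nlinarith
  rw [Real.dist_eq, abs_sub_comm]
  refine le_trans ?_ (le_abs_self _)
  linarith

end numSamples

/-- Keep the first `n` samples, and all the costs. -/
def truncate (n : ℕ) (ω : (ℕ → ℝ) × (ℕ → ℝ)) : (Fin n → ℝ) × (ℕ → ℝ) :=
  (fun i => ω.1 i, ω.2)

/-- Continue the first `n` samples by zeros. -/
def padZero (n : ℕ) (p : (Fin n → ℝ) × (ℕ → ℝ)) : (ℕ → ℝ) × (ℕ → ℝ) :=
  (fun i => if h : i < n then p.1 ⟨i, h⟩ else 0, p.2)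

lemma measurable_truncate (n : ℕ) : Measurable (truncate n) := by
  unfold truncate
  fun_prop

lemma measurable_padZero (n : ℕ) : Measurable (padZero n) := by
  unfold padZero
  refine Measurable.prodMk (measurable_pi_lambda _ fun i => ?_) measurable_snd
  by_cases h : i < n
  · simp only [h, dite_true]
    fun_prop
  · simp only [h, dite_false]
    fun_prop

lemma map_truncate_envLaw (κ 𝒞 : ProbabilityMeasure ℝ) (n : ℕ) :
    (envLaw κ 𝒞).map (truncate n) = (Measure.pi fun _ : Fin n => (κ : Measure ℝ)).prod
      (Measure.infinitePi fun _ : ℕ => (𝒞 : Measure ℝ)) := by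
  have h := Measure.map_infinitePi_infinitePi_of_inj (P := fun _ : ℕ => (κ : Measure ℝ))
    (f := fun i : Fin n => (i : ℕ)) Fin.val_injective
  rw [Measure.infinitePi_eq_pi (μ := fun _ : Fin n => (κ : Measure ℝ))] at h
  have h2 := Measure.map_prod_map (Measure.infinitePi fun _ : ℕ => (κ : Measure ℝ))
    (Measure.infinitePi fun _ : ℕ => (𝒞 : Measure ℝ))
    (f := fun ω (i : Fin n) => ω i) (g := id) (by fun_prop) measurable_id
  rw [h, Measure.map_id] at h2
  rw [h2]
  rfl

lemma klDiv_map_truncate_le (ν κ 𝒞 : ProbabilityMeasure ℝ) (n : ℕ) :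
    klDiv ((envLaw ν 𝒞).map (truncate n)) ((envLaw κ 𝒞).map (truncate n)) ≤
      n * klDiv (ν : Measure ℝ) κ := by
  rw [map_truncate_envLaw, map_truncate_envLaw]
  refine (klDiv_prod_le _ _ _ _).trans ?_
  rw [klDiv_self, add_zero]
  exact klDiv_pi_le _ _ n

/-- Change of measure for events that depend on the first `n` samples and on the costs. -/
lemma mul_envLaw_le {ν κ : ProbabilityMeasure ℝ} (𝒞 : ProbabilityMeasure ℝ)
    (hfin : klDiv (ν : Measure ℝ) κ ≠ ⊤) {n : ℕ} {B : Set ((ℕ → ℝ) × (ℕ → ℝ))}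
    (hB : MeasurableSet B) (hdep : ∀ ω, padZero n (truncate n ω) ∈ B ↔ ω ∈ B) (t : ℝ) :
    t * (envLaw ν 𝒞).real B ≤ n * (klDiv (ν : Measure ℝ) κ).toReal +
      Real.log (1 + (Real.exp t - 1) * (envLaw κ 𝒞).real B) := by
  have hm := measurable_truncate n
  -- Zero padding exhibits `B` as the preimage of a measurable set of truncated data.
  have hpre : truncate n ⁻¹' (padZero n ⁻¹' B) = B := Set.ext hdep
  have hB' : MeasurableSet (padZero n ⁻¹' B) := measurable_padZero n hB
  have hreal (ρ : ProbabilityMeasure ℝ) :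
      ((envLaw ρ 𝒞).map (truncate n)).real (padZero n ⁻¹' B) = (envLaw ρ 𝒞).real B := by
    rw [map_measureReal_apply hm hB', hpre]
  have hle := klDiv_map_truncate_le ν κ 𝒞 n
  have hfin' : (n : ENNReal) * klDiv (ν : Measure ℝ) κ ≠ ⊤ :=
    ENNReal.mul_ne_top (ENNReal.natCast_ne_top n) hfin
  have hp (ρ : ProbabilityMeasure ℝ) : IsProbabilityMeasure ((envLaw ρ 𝒞).map (truncate n)) :=
    Measure.isProbabilityMeasure_map hm.aemeasurable
  have h := mul_measureReal_le_toReal_klDiv_add_log ((envLaw ν 𝒞).map (truncate n))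
    ((envLaw κ 𝒞).map (truncate n)) (ne_top_of_le_ne_top hfin' hle) hB' t
  rw [hreal, hreal] at h
  have := ENNReal.toReal_mono hfin' hle
  rw [ENNReal.toReal_mul, ENNReal.toReal_natCast] at this
  linarith

lemma truncate_padZero_mem_iff (π : Policy) (C δ m : ℝ) (n : ℕ) (ω : (ℕ → ℝ) × (ℕ → ℝ)) :
    padZero n (truncate n ω) ∈ (π.coverSet C δ m)ᶜ ∩ {ω | numSamples C ω.2 ≤ n} ↔
      ω ∈ (π.coverSet C δ m)ᶜ ∩ {ω | numSamples C ω.2 ≤ n} := by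
  have hsnd : (padZero n (truncate n ω)).2 = ω.2 := rfl
  simp only [Set.mem_inter_iff, Set.mem_ofPred_eq, hsnd]
  refine and_congr_left fun hn => ?_
  have hfst : (fun i : Fin (numSamples C ω.2) => (padZero n (truncate n ω)).1 i) =
      fun i : Fin (numSamples C ω.2) => ω.1 i := by
    funext i
    simp [padZero, truncate, i.2.trans_le hn]
  change ¬ (m : EReal) ∈ Set.Icc
      (π.lower (numSamples C ω.2) δ fun i : Fin (numSamples C ω.2) =>
        (padZero n (truncate n ω)).1 i)
      (π.upper (numSamples C ω.2) δ fun i : Fin (numSamples C ω.2) =>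
        (padZero n (truncate n ω)).1 i) ↔ _
  rw [hfst]
  rfl

/-- A confidence interval with the prescribed coverage cannot exclude the mean of `κ` under `ν`
with high probability unless the budget suffices to distinguish `ν` from `κ`. -/
theorem not_tendsto_envLaw_coverSet {P : Set (ProbabilityMeasure ℝ)} {ν κ 𝒞 : ProbabilityMeasure ℝ}
    (hpos : ∀ᵐ c ∂(𝒞 : Measure ℝ), 0 < c) (hint : Integrable (fun c : ℝ => c) (𝒞 : Measure ℝ))
    {C : ℝ → ℝ} (hC : Tendsto C (𝓝[>] 0) atTop) {π : Policy} (hcov : π.Covers P 𝒞 C)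
    (hκ : κ ∈ P) (hfin : klDiv (ν : Measure ℝ) κ ≠ ⊤) {k : ℝ} (hk : 0 ≤ k)
    (hCk : Tendsto (fun δ => C δ / Real.log (1 / δ)) (𝓝[>] 0) (𝓝 k))
    (hlt : k * (klDiv (ν : Measure ℝ) κ).toReal < mean 𝒞) :
    ¬ Tendsto (fun δ => envLaw ν 𝒞 (π.coverSet (C δ) δ (mean κ))) (𝓝[>] 0) (𝓝 0) := by
  intro hA
  set D := (klDiv (ν : Measure ℝ) κ).toReal with hD
  have hD0 : 0 ≤ D := ENNReal.toReal_nonneg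
  have hcpos := mean_pos hpos hint
  have hq : 0 ≤ k * D := mul_nonneg hk hD0
  -- Lies strictly between 1/c̄ and 1/(kD), and stays meaningful when kD = 0.
  set θ := 2 / (mean 𝒞 + k * D) with hθ_def
  have hθ : 0 < θ := by positivity
  have hθ1 : 1 < θ * mean 𝒞 := by
    rw [hθ_def, div_mul_eq_mul_div, lt_div_iff₀ (by positivity)]
    linarith
  have hθ2 : θ * k * D < 1 := by
    rw [mul_assoc, hθ_def, div_mul_eq_mul_div, div_lt_iff₀ (by positivity)]
    linarith
  have hG : Tendsto (fun δ => envLaw ν 𝒞 {ω | ⌈θ * C δ⌉₊ < numSamples (C δ) ω.2}) (𝓝[>] 0)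
      (𝓝 0) := by
    refine ((tendsto_lt_numSamples hpos hint hθ hθ1).comp hC).congr fun δ => ?_
    exact ((measurePreserving_snd
      (μ := Measure.infinitePi fun _ : ℕ => (ν : Measure ℝ))).measure_preimage (measurableSet_lt measurable_const (measurable_numSamples _)).nullMeasurableSet).symm
  have hA' := (ENNReal.tendsto_toReal ENNReal.zero_ne_top).comp hA
  have hG' := (ENNReal.tendsto_toReal ENNReal.zero_ne_top).comp hG
  have hlog : Tendsto (fun δ : ℝ => Real.log (1 / δ)) (𝓝[>] 0) atTop := by
    simp only [one_div]
    exact Real.tendsto_log_atTop.comp tendsto_inv_nhdsGT_zero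
  have hinv : Tendsto (fun δ : ℝ => (Real.log (1 / δ))⁻¹) (𝓝[>] 0) (𝓝 0) := hlog.inv_tendsto_atTop
  have hlower : Tendsto (fun δ => 1 - (envLaw ν 𝒞).real (π.coverSet (C δ) δ (mean κ)) -
      (envLaw ν 𝒞).real {ω | ⌈θ * C δ⌉₊ < numSamples (C δ) ω.2}) (𝓝[>] 0) (𝓝 1) := by
    have h := ((tendsto_const_nhds (x := (1 : ℝ))).sub hA').sub hG'
    simp only [ENNReal.toReal_zero, sub_zero] at h
    exact h
  have hupper : Tendsto (fun δ => (θ * (C δ / Real.log (1 / δ)) + (Real.log (1 / δ))⁻¹) * D +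
      Real.log 2 * (Real.log (1 / δ))⁻¹) (𝓝[>] 0) (𝓝 (θ * k * D)) := by
    simpa using (((hCk.const_mul θ).add hinv).mul_const D).add (hinv.const_mul (Real.log 2))
  refine hθ2.not_ge (le_of_tendsto_of_tendsto hlower hupper ?_)
  filter_upwards [Ioo_mem_nhdsGT (zero_lt_one' ℝ), hC.eventually_ge_atTop 0] with δ hδ hCδ
  -- With this multiplier, (exp t - 1) κ(B) ≤ (1/δ - 1) δ ≤ 1, so the log term is at most log 2.
  set t := Real.log (1 / δ) with ht_def
  have ht : 0 < t := Real.log_pos (by rw [lt_div_iff₀ hδ.1]; linarith [hδ.2])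
  have hexp : Real.exp t = 1 / δ := Real.exp_log (by have := hδ.1; positivity)
  set A := π.coverSet (C δ) δ (mean κ) with hA_def
  have hAm : MeasurableSet A := π.measurableSet_coverSet _ _ _
  set n := ⌈θ * C δ⌉₊ with hn_def
  set G : Set ((ℕ → ℝ) × (ℕ → ℝ)) := {ω | numSamples (C δ) ω.2 ≤ n} with hG_def
  have hGm : MeasurableSet G :=
    measurableSet_le ((measurable_numSamples _).comp measurable_snd) measurable_const
  have hcm := mul_envLaw_le 𝒞 hfin (hAm.compl.inter hGm)
    (truncate_padZero_mem_iff π (C δ) δ (mean κ) n) t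
  have hκB : (envLaw κ 𝒞).real (Aᶜ ∩ G) ≤ δ := by
    have h1 : 1 - δ ≤ (envLaw κ 𝒞).real A :=
      (ENNReal.ofReal_le_iff_le_toReal (measure_ne_top _ _)).1 (hcov δ hδ κ hκ)
    have h2 := measureReal_mono (μ := envLaw κ 𝒞) (Set.inter_subset_left (s := Aᶜ) (t := G))
    rw [probReal_compl_eq_one_sub hAm] at h2
    linarith
  have hνB : 1 - (envLaw ν 𝒞).real A - (envLaw ν 𝒞).real {ω | n < numSamples (C δ) ω.2} ≤
      (envLaw ν 𝒞).real (Aᶜ ∩ G) := by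
    have hcompl : (Aᶜ ∩ G)ᶜ = A ∪ {ω | n < numSamples (C δ) ω.2} := by
      ext ω
      simp [hG_def, or_iff_not_imp_left]
    have h1 := measureReal_union_le (μ := envLaw ν 𝒞) A {ω | n < numSamples (C δ) ω.2}
    rw [← hcompl, probReal_compl_eq_one_sub (hAm.compl.inter hGm)] at h1
    linarith
  have hlog2 : Real.log (1 + (Real.exp t - 1) * (envLaw κ 𝒞).real (Aᶜ ∩ G)) ≤ Real.log 2 := by
    have h0 : 0 ≤ (envLaw κ 𝒞).real (Aᶜ ∩ G) := measureReal_nonneg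
    have h1 : 0 < Real.exp t - 1 := by linarith [Real.add_one_lt_exp ht.ne']
    have h2 : Real.exp t * δ = 1 := by
      rw [hexp, one_div, inv_mul_cancel₀ hδ.1.ne']
    apply Real.log_le_log
    · nlinarith [mul_nonneg h1.le h0]
    · nlinarith [mul_le_mul_of_nonneg_left hκB h1.le, hδ.1]
  have hn : (n : ℝ) ≤ θ * C δ + 1 := (Nat.ceil_lt_add_one (by positivity)).le
  have hfinal : t * (envLaw ν 𝒞).real (Aᶜ ∩ G) ≤ (θ * C δ + 1) * D + Real.log 2 := by
    nlinarith [mul_le_mul_of_nonneg_right hn hD0]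
  refine hνB.trans ?_
  have hrw : (θ * (C δ / t) + t⁻¹) * D + Real.log 2 * t⁻¹ =
      ((θ * C δ + 1) * D + Real.log 2) / t := by
    field_simp
  rw [hrw, le_div_iff₀ ht]
  linarith

/-- If m(κ) lay outside [L, R], convergence of the nearer endpoint would drive the probability of
containing m(κ) to 0. -/
lemma Policy.StableAt.le_mean_le {P : Set (ProbabilityMeasure ℝ)} {ν κ 𝒞 : ProbabilityMeasure ℝ}
    (hpos : ∀ᵐ c ∂(𝒞 : Measure ℝ), 0 < c) (hint : Integrable (fun c : ℝ => c) (𝒞 : Measure ℝ))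
    {C : ℝ → ℝ} (hC : Tendsto C (𝓝[>] 0) atTop) {π : Policy} (hcov : π.Covers P 𝒞 C)
    {L R : EReal} (hstable : π.StableAt ν 𝒞 C L R)
    (hκ : κ ∈ P) (hfin : klDiv (ν : Measure ℝ) κ ≠ ⊤) {k : ℝ} (hk : 0 ≤ k)
    (hCk : Tendsto (fun δ => C δ / Real.log (1 / δ)) (𝓝[>] 0) (𝓝 k))
    (hlt : k * (klDiv (ν : Measure ℝ) κ).toReal < mean 𝒞) :
    L ≤ (mean κ : EReal) ∧ (mean κ : EReal) ≤ R := by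
  have hnot := not_tendsto_envLaw_coverSet hpos hint hC hcov hκ hfin hk hCk hlt
  constructor
  · by_contra! hcon
    refine hnot (tendsto_of_tendsto_of_tendsto_of_le_of_le tendsto_const_nhds
      (hstable.2.2.1 _ (Ioi_mem_nhds hcon)) (fun _ => bot_le) fun δ => measure_mono fun ω hω => ?_)
    exact not_lt.2 hω.1
  · by_contra! hcon
    refine hnot (tendsto_of_tendsto_of_tendsto_of_le_of_le tendsto_const_nhds
      (hstable.2.2.2 _ (Iio_mem_nhds hcon)) (fun _ => bot_le) fun δ => measure_mono fun ω hω => ?_)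
    exact not_lt.2 hω.2

end CIWidth

/-! ### Passage to the limits and the two regimes. -/

namespace CIWidth

lemma coe_le_of_forall_lt {b : ℝ} {R : EReal} (h : ∀ y : ℝ, y < b → (y : EReal) ≤ R) :
    (b : EReal) ≤ R := by
  by_contra! hcon
  obtain ⟨y, h1, h2⟩ := EReal.lt_iff_exists_real_btwn.1 hcon
  exact (h y (EReal.coe_lt_coe_iff.1 h2)).not_gt h1

lemma le_coe_of_forall_gt {a : ℝ} {L : EReal} (h : ∀ y : ℝ, a < y → L ≤ (y : EReal)) :
    L ≤ (a : EReal) := by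
  by_contra! hcon
  obtain ⟨y, h1, h2⟩ := EReal.lt_iff_exists_real_btwn.1 hcon
  exact (h y (EReal.coe_lt_coe_iff.1 h1)).not_gt h2

lemma TendstoInProb.mem_of_isClosed {Ω : Type*} [MeasurableSpace Ω] {μ : Measure Ω}
    [IsProbabilityMeasure μ] {Y : ℝ → Ω → EReal} {a : EReal} (h : TendstoInProb μ Y a)
    {s : Set EReal} (hs : IsClosed s) (hY : ∀ δ ∈ Set.Ioo (0 : ℝ) 1, ∀ ω, Y δ ω ∈ s) : a ∈ s := by
  by_contra hcon
  have h0 := h sᶜ (hs.isOpen_compl.mem_nhds hcon)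
  have h1 : Tendsto (fun δ => μ {ω | Y δ ω ∉ sᶜ}) (𝓝[>] (0 : ℝ)) (𝓝 1) := by
    refine tendsto_const_nhds.congr' ?_
    filter_upwards [Ioo_mem_nhdsGT (zero_lt_one' ℝ)] with δ hδ
    have : {ω | Y δ ω ∉ sᶜ} = Set.univ := by
      ext ω
      simpa using hY δ hδ ω
    rw [this, measure_univ]
  exact zero_ne_one (tendsto_nhds_unique h0 h1)

end CIWidth

open CIWidth

theorem theorem5
    (P : Set (ProbabilityMeasure ℝ))
    (hP : P = CIWidth.boundedFamily ∨
      ∃ ε Γ : ℝ, 0 < ε ∧ 0 < Γ ∧ P = CIWidth.momentFamily ε Γ)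
    (ν : ProbabilityMeasure ℝ) (hν : ν ∈ P)
    (𝒞 : ProbabilityMeasure ℝ) (h𝒞pos : ∀ᵐ c ∂(𝒞 : Measure ℝ), 0 < c)
    (h𝒞int : Integrable (fun c : ℝ => c) (𝒞 : Measure ℝ))
    (C : ℝ → ℝ) (hC : Tendsto C (𝓝[>] 0) atTop)
    (π : CIWidth.Policy) (hcov : π.Covers P 𝒞 C)
    (L R : EReal) (hstable : π.StableAt ν 𝒞 C L R) :
    -- no learning regime
    (Tendsto (fun δ => C δ / Real.log (1 / δ)) (𝓝[>] 0) (𝓝 0) →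
      (L ≤ CIWidth.minMean P ∧ CIWidth.maxMean P ≤ R ∧
        CIWidth.maxMean P - CIWidth.minMean P ≤ R - L) ∧
      (π.ReportsWithin P →
        R - L = CIWidth.maxMean P - CIWidth.minMean P ∧
        CIWidth.TendstoInProb (CIWidth.envLaw ν 𝒞) (fun δ => π.lowerAt (C δ) δ)
          (CIWidth.minMean P) ∧
        CIWidth.TendstoInProb (CIWidth.envLaw ν 𝒞) (fun δ => π.upperAt (C δ) δ)
          (CIWidth.maxMean P))) ∧
    -- sufficient learning regime
    (∀ k : ℝ, 0 < k → Tendsto (fun δ => C δ / Real.log (1 / δ)) (𝓝[>] 0) (𝓝 k) →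
      CIWidth.minMean P < (CIWidth.mean ν : EReal) →
      (CIWidth.mean ν : EReal) < CIWidth.maxMean P →
      ∃ xL xR : ℝ,
        CIWidth.SolvesSystem ν P (CIWidth.mean 𝒞 / k) xL xR ∧
        (∀ yL yR : ℝ, CIWidth.SolvesSystem ν P (CIWidth.mean 𝒞 / k) yL yR →
          yL = xL ∧ yR = xR) ∧
        ((xR - xL : ℝ) : EReal) ≤ R - L) := by
  obtain ⟨a, b, ha, hb⟩ := exists_extremalFunctional hP
  rw [maxMean_eq hb, minMean_eq ha]
  have hcpos := mean_pos h𝒞pos h𝒞int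
  constructor
  · intro hC0
    have hbound {κ : ProbabilityMeasure ℝ} (hκ : κ ∈ P)
        (hfin : InformationTheory.klDiv (ν : Measure ℝ) κ ≠ ⊤) :=
      hstable.le_mean_le h𝒞pos h𝒞int hC hcov hκ hfin le_rfl hC0 (by rwa [zero_mul])
    have hR : (b : EReal) ≤ R := by
      refine coe_le_of_forall_lt fun y hy => ?_
      obtain ⟨κ, hκ, hyκ, hfin⟩ :=
        exists_of_klLevel_lt (lt_top_iff_ne_top.2 (hb.klLevel_ne_top hν hy))
      exact (EReal.coe_le_coe_iff.2 (by linarith)).trans (hbound hκ hfin.ne).2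
    have hL : L ≤ (a : EReal) := by
      refine le_coe_of_forall_gt fun y hy => ?_
      obtain ⟨κ, hκ, hyκ, hfin⟩ :=
        exists_of_klLevel_lt (lt_top_iff_ne_top.2 (ha.klLevel_ne_top hν (neg_lt_neg hy)))
      exact (hbound hκ hfin.ne).1.trans (EReal.coe_le_coe_iff.2 (by linarith))
    refine ⟨⟨hL, hR, EReal.sub_le_sub hR hL⟩, fun hrep => ?_⟩
    rw [CIWidth.Policy.ReportsWithin, maxMean_eq hb, minMean_eq ha] at hrep
    -- Limits in probability of variables confined to a closed set stay in it, so the limits are the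
    -- extreme means and stability already is the claimed convergence.
    obtain rfl : R = b := le_antisymm
      (hstable.2.2.2.mem_of_isClosed isClosed_Iic fun δ hδ ω => (hrep _ δ hδ _).2) hR
    obtain rfl : L = a := le_antisymm hL
      (hstable.2.2.1.mem_of_isClosed isClosed_Ici fun δ hδ ω => (hrep _ δ hδ _).1)
    exact ⟨rfl, hstable.2.2⟩
  · intro k hk hCk hνa hνb
    rw [EReal.coe_lt_coe_iff] at hνa hνb
    have hr : 0 < mean 𝒞 / k := div_pos hcpos hk
    have hbound {κ : ProbabilityMeasure ℝ} (hκ : κ ∈ P)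
        (hlt : InformationTheory.klDiv (ν : Measure ℝ) κ < ENNReal.ofReal (mean 𝒞 / k)) :
        L ≤ (mean κ : EReal) ∧ (mean κ : EReal) ≤ R := by
      have hfin := (hlt.trans_le le_top).ne
      refine hstable.le_mean_le h𝒞pos h𝒞int hC hcov hκ hfin hk.le hCk ?_
      have := (ENNReal.lt_ofReal_iff_toReal_lt hfin).1 hlt
      rwa [lt_div_iff₀ hk, mul_comm] at this
    obtain ⟨x, hνx, hx⟩ := hb.exists_klLevel_eq hν (by simpa using hνb) hr
    obtain ⟨z, hνz, hz⟩ := ha.exists_klLevel_eq hν (by simpa using hνa) hr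
    refine ⟨-z, x, ⟨by linarith, by linarith, ?_, ?_⟩, fun yL yR h => ?_, ?_⟩
    · rw [klInf_eq_klLevel_of_ge (by linarith), hx]
    · rw [klInf_eq_klLevel_of_lt (by linarith), neg_neg, hz]
    · obtain ⟨h1, h2, h3, h4⟩ := h
      rw [klInf_eq_klLevel_of_ge h2.le] at h3
      rw [klInf_eq_klLevel_of_lt h1] at h4
      exact ⟨neg_eq_iff_eq_neg.1 (ha.klLevel_injective hν hr h4 hz),
        hb.klLevel_injective hν hr h3 hx⟩
    · rw [EReal.coe_sub]
      refine EReal.sub_le_sub (coe_le_of_forall_lt fun y hy => ?_)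
        (le_coe_of_forall_gt fun y hy => ?_)
      -- Strict monotonicity leaves room below c̄/k for a law of mean at least `y`.
      · obtain ⟨κ, hκ, hyκ, hlt⟩ := exists_of_klLevel_lt (hb.klLevel_lt_of_lt hν hr hy hx)
        exact (EReal.coe_le_coe_iff.2 (by linarith)).trans (hbound hκ hlt).2
      · obtain ⟨κ, hκ, hyκ, hlt⟩ :=
          exists_of_klLevel_lt (ha.klLevel_lt_of_lt hν hr (by linarith : -y < z) hz)
        exact (hbound hκ hlt).1.trans (EReal.coe_le_coe_iff.2 (by linarith))
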